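/- **Proposition (error estimate for $p>1$).** Let $d\ge 1$, let $\Omega\subset\mathbb{R}^d$ be a bounded open set, let $1<p<2$, and let $\varepsilon_0,c_1,c_2,c_\infty,\sigma,\kappa>0$. Then there is a constant $C>0$, depending only on these data, with the following property. Let $0<\varepsilon\le\varepsilon_0$ and let $\varphi:[0,\infty)\to[0,\infty)$ satisfy: * (C1) $\varphi$ is convex and continuously differentiable with $\varphi(0)=0$; * (C2) $s\mapsto\varphi'(s)/s$ (understood as the limit from the right at $s=0$) is positive, nonincreasing and continuous on $[0,\infty)$; * (C3) $\varphi\in C([0,\infty))\cap C^2((0,\infty))$ is convex, $\varphi>0$ on $(0,\infty)$, $\varphi(0)=0$, $\lim_{s\to0}\varphi(s)/s=0$ and $\lim_{s\to\infty}\varphi(s)/s=\infty$; with the convex conjugate $\varphi^*(r)=\sup_{s\ge0}(rs-\varphi(s))$ one has $\varphi(2s)\le\kappa\varphi(s)$ and $\varphi^*(2r)\le\kappa\varphi^*(r)$ for all $r,s\ge0$; and $\varphi'(s)\le\kappa\,\varphi''(s)s$ and $\varphi''(s)s\le\kappa\,\varphi'(s)$ for all $s>0$; * $c_1\max\{s,\varepsilon\}^{p-2}\le\varphi'(s)/s\le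 c_2\,\varepsilon^{p-2}$ for all $s\ge0$. Let $\Gamma_{\rm D}\subset\partial\Omega$ be closed (possibly empty). Let $\mathcal{T}_h$ be a conforming triangulation of $\overline\Omega$ into finitely many $d$-simplices with maximal diameter $h$ that is quasi-uniform in the sense that every $T\in\mathcal{T}_h$ contains a closed ball of radius $\sigma h$. Let $X_h$ be the space of continuous functions on $\overline\Omega$ that are affine on every $T\in\mathcal{T}_h$ and vanish almost everywhere on $\Gamma_{\rm D}$ with respect to the $(d-1)$-dimensional Hausdorff measure. Let $\tau>0$, $K\in\mathbb{N}_0$, write $(\cdot,\cdot)$ and $\|\cdot\|$ for the inner product and norm of $L^2(\Omega)$, $d_tc^k=(c^k-c^{k-1})/\tau$, and $E_\varphi[v]=\int_\Omega\varphi(|\nabla v|)\,dx$. Let $(u_h^k)_{k=0,\dots,K}$ and $(\widetilde u_h^k)_{k=0,\dots,K}$ in $X_h$ satisfy $\widetilde u_h^0=u_h^0$ and, for $k=1,\dots,K$ and all $v_h\in X_h$, $$(d_tu_h^k,v_h)+\Big(\frac{\varphi'(|\nabla u_h^{k-1}|)}{|\nabla u_h^{k-1}|}\nabla u_h^k,\nabla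 v_h\Big)=0,\qquad (d_t\widetilde u_h^k,v_h)+\Big(\frac{\varphi'(|\nabla\widetilde u_h^k|)}{|\nabla\widetilde u_h^k|}\nabla\widetilde u_h^k,\nabla v_h\Big)=0,$$ and assume that $$\max_{k=0,\dots,K}\|u_h^k\|_{L^\infty(\Omega)}+\max_{k=0,\dots,K}\|\widetilde u_h^k\|_{L^\infty(\Omega)}\le c_\infty.$$ Then $$\max_{k=0,\dots,K}\|\widetilde u_h^k-u_h^k\|\le C\,\big(E_\varphi[u_h^0]\big)^{1/2}\,\tau^{1/2}\,(h\varepsilon)^{(p-2)/2}.$$ -/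

import Mathlib

open Set Filter Topology MeasureTheory
open scoped Gradient

noncomputable section

namespace PLaplaceFlow

/-! ### Energy densities

An energy density `φ : [0, ∞) → [0, ∞)` is represented by a function `φ : ℝ → ℝ`
of which only the values on `[0, ∞)` are used. -/

/-- The weight `s ↦ φ'(s) / s` on `[0, ∞)`; at `s = 0` it is the limit from the right. -/
def weight (φ : ℝ → ℝ) (s : ℝ) : ℝ :=
  if 0 < s then deriv φ s / s else limUnder (𝓝[>] (0 : ℝ)) (fun r => deriv φ r / r)

/-- The convex conjugate `φ*(r) = sup_{s ≥ 0} (r s - φ(s))`. -/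
def conjugate (φ : ℝ → ℝ) (r : ℝ) : ℝ :=
  sSup ((fun s => r * s - φ s) '' Ici 0)

/-- Condition (C1): `φ : [0, ∞) → [0, ∞)` is convex and continuously differentiable,
and `φ(0) = 0`. -/
structure CondC1 (φ : ℝ → ℝ) : Prop where
  nonneg : ∀ s, 0 ≤ s → 0 ≤ φ s
  convex : ConvexOn ℝ (Ici 0) φ
  contDiff : ContDiffOn ℝ 1 φ (Ici 0)
  map_zero : φ 0 = 0

/-- Condition (C2): `s ↦ φ'(s) / s` is positive, nonincreasing and continuous on `[0, ∞)`. -/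
structure CondC2 (φ : ℝ → ℝ) : Prop where
  pos : ∀ s, 0 ≤ s → 0 < weight φ s
  antitone : AntitoneOn (weight φ) (Ici 0)
  continuous : ContinuousOn (weight φ) (Ici 0)

/-- Condition (C3), in which all the implied constants are bounded by `κ`:
`φ` is continuous on `[0, ∞)` and twice continuously differentiable on `(0, ∞)`, convex,
positive on `(0, ∞)`, zero at `0`, sublinear at `0` and superlinear at `∞`; `φ` and its convex
conjugate satisfy the doubling condition; and `s φ''(s)` is equivalent to `φ'(s)`. -/
structure CondC3 (κ : ℝ) (φ : ℝ → ℝ) : Prop where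
  continuous : ContinuousOn φ (Ici 0)
  contDiff : ContDiffOn ℝ 2 φ (Ioi 0)
  convex : ConvexOn ℝ (Ici 0) φ
  pos : ∀ s, 0 < s → 0 < φ s
  map_zero : φ 0 = 0
  tendsto_zero : Tendsto (fun s => φ s / s) (𝓝[>] 0) (𝓝 0)
  tendsto_atTop : Tendsto (fun s => φ s / s) atTop atTop
  doubling : ∀ s, 0 ≤ s → φ (2 * s) ≤ κ * φ s
  doubling_conjugate : ∀ r, 0 ≤ r → conjugate φ (2 * r) ≤ κ * conjugate φ r
  deriv_le : ∀ s, 0 < s → deriv φ s ≤ κ * (deriv (deriv φ) s * s)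
  le_deriv : ∀ s, 0 < s → deriv (deriv φ) s * s ≤ κ * deriv φ s

variable {d : ℕ}

/-! ### Triangulations and finite element spaces -/

/-- A (conforming) triangulation of `Ω ⊆ ℝ^d`: a finite simplicial complex covering exactly
the closure of `Ω`. As `Ω` is open, every face is then a face of a `d`-dimensional one. -/
structure IsTriangulation (Ω : Set (EuclideanSpace ℝ (Fin d)))
    (𝒯 : Geometry.SimplicialComplex ℝ (EuclideanSpace ℝ (Fin d))) : Prop where
  finite : 𝒯.faces.Finite
  space_eq : 𝒯.space = closure Ω

/-- The elements of the triangulation: its `d`-dimensional simplices, as vertex sets. -/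
def elements (𝒯 : Geometry.SimplicialComplex ℝ (EuclideanSpace ℝ (Fin d))) :
    Set (Finset (EuclideanSpace ℝ (Fin d))) :=
  {T | T ∈ 𝒯.faces ∧ T.card = d + 1}

/-- The maximal mesh-size `h = max_T diam T`. -/
def meshSize (𝒯 : Geometry.SimplicialComplex ℝ (EuclideanSpace ℝ (Fin d))) : ℝ :=
  sSup ((fun T : Finset (EuclideanSpace ℝ (Fin d)) =>
    Metric.diam (convexHull ℝ (T : Set (EuclideanSpace ℝ (Fin d))))) '' elements 𝒯)

/-- Quasi-uniformity with parameter `σ`: every element contains a ball of radius `σ h`, where `h`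
is the maximal mesh-size (this includes shape regularity). -/
def IsQuasiUniform (σ : ℝ)
    (𝒯 : Geometry.SimplicialComplex ℝ (EuclideanSpace ℝ (Fin d))) : Prop :=
  ∀ T ∈ elements 𝒯, ∃ x, Metric.closedBall x (σ * meshSize 𝒯) ⊆
    convexHull ℝ (T : Set (EuclideanSpace ℝ (Fin d)))

/-- The space `V_h` of functions that are continuous on the closure of `Ω` and affine on each
element. Functions are defined on all of `ℝ^d`, but only their values on the closure of `Ω`
matter. -/
def feSpace (Ω : Set (EuclideanSpace ℝ (Fin d)))
    (𝒯 : Geometry.SimplicialComplex ℝ (EuclideanSpace ℝ (Fin d))) :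
    Set (EuclideanSpace ℝ (Fin d) → ℝ) :=
  {v | ContinuousOn v (closure Ω) ∧
    ∀ T ∈ elements 𝒯, ∃ g : EuclideanSpace ℝ (Fin d) →ᵃ[ℝ] ℝ,
      EqOn v g (convexHull ℝ (T : Set (EuclideanSpace ℝ (Fin d))))}

/-- The space `X_h` of the functions in `V_h` that vanish on `Γ_D`. As in the Sobolev space
`W^{1,p}_D(Ω)`, the trace (here: the restriction) vanishes almost everywhere
on `Γ_D` with respect to the surface measure. -/
def feSpaceD (Ω ΓD : Set (EuclideanSpace ℝ (Fin d)))
    (𝒯 : Geometry.SimplicialComplex ℝ (EuclideanSpace ℝ (Fin d))) :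
    Set (EuclideanSpace ℝ (Fin d) → ℝ) :=
  {v | v ∈ feSpace Ω 𝒯 ∧ ∀ᵐ x ∂(μH[(d : ℝ) - 1].restrict ΓD), v x = 0}

/-! ### Energy and schemes

Functions in `V_h` are differentiable in the interiors of the elements, hence almost everywhere
in `Ω`, and there the weak gradient is the classical one. -/

/-- The energy `E_φ[u] = ∫_Ω φ(|∇u|) dx`. -/
def energy (φ : ℝ → ℝ) (Ω : Set (EuclideanSpace ℝ (Fin d)))
    (u : EuclideanSpace ℝ (Fin d) → ℝ) : ℝ :=
  ∫ x in Ω, φ ‖∇ u x‖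

/-- The sequence `u⁰, …, u^K` in `Xh` is generated by the semi-implicit scheme with step size `τ`:
`(d_t u^k, v) + (φ'(|∇u^{k-1}|) / |∇u^{k-1}| ∇u^k, ∇v) = 0` for all `v ∈ Xh`, `k = 1, …, K`. -/
def IsSemiImplicit (φ : ℝ → ℝ) (Ω : Set (EuclideanSpace ℝ (Fin d)))
    (Xh : Set (EuclideanSpace ℝ (Fin d) → ℝ)) (τ : ℝ) (K : ℕ)
    (u : ℕ → EuclideanSpace ℝ (Fin d) → ℝ) : Prop :=
  (∀ k ≤ K, u k ∈ Xh) ∧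
  ∀ k, 1 ≤ k → k ≤ K → ∀ v ∈ Xh,
    (∫ x in Ω, (u k x - u (k - 1) x) / τ * v x) +
      (∫ x in Ω, weight φ ‖∇ (u (k - 1)) x‖ * inner ℝ (∇ (u k) x) (∇ v x)) = 0

/-- The sequence `u⁰, …, u^K` in `Xh` is generated by the implicit scheme with step size `τ`:
`(d_t u^k, v) + (φ'(|∇u^k|) / |∇u^k| ∇u^k, ∇v) = 0` for all `v ∈ Xh`, `k = 1, …, K`. -/
def IsImplicit (φ : ℝ → ℝ) (Ω : Set (EuclideanSpace ℝ (Fin d)))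
    (Xh : Set (EuclideanSpace ℝ (Fin d) → ℝ)) (τ : ℝ) (K : ℕ)
    (u : ℕ → EuclideanSpace ℝ (Fin d) → ℝ) : Prop :=
  (∀ k ≤ K, u k ∈ Xh) ∧
  ∀ k, 1 ≤ k → k ≤ K → ∀ v ∈ Xh,
    (∫ x in Ω, (u k x - u (k - 1) x) / τ * v x) +
      (∫ x in Ω, weight φ ‖∇ (u k) x‖ * inner ℝ (∇ (u k) x) (∇ v x)) = 0

end PLaplaceFlow

end

open PLaplaceFlow

namespace PLaplaceFlow

/-! ### Pointwise inequalities for the energy density -/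

section Density

variable {φ : ℝ → ℝ}

/-! Write a(s) = φ'(s)/s. As a is nonincreasing, φ lies below the parabola with coefficient a(s)/2
touching it at s. Testing the semi-implicit step with its increment therefore decreases the energy
by at least half of ∫ a(|∇u^{k-1}|) |∇(u^k - u^{k-1})|², for every step size
(`energy_add_dissipation_le`).

For the error, both schemes are tested with the new difference. Lagging the weight costs
(a(|∇u^{k-1}|) - a(|∇u^k|)) ∇u^k, which is at most a(|∇u^{k-1}|) |∇(u^k - u^{k-1})| because s a(s)
is nondecreasing (`abs_weight_sub_mul_norm_le`). Young's inequality splits this into the dissipation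
and a part absorbed by strong monotonicity of the implicit flux (`inner_error_le`). The monotonicity
constant m is positive only on bounded gradients: the inverse estimate bounds them by a multiple of
1/h, so m is of order h^(2-p). With a ≤ W = c₂ ε^(p-2), the errors telescope against the energy,
without Gronwall, to ‖e^k‖² ≤ τ (W/m) E[u⁰]. -/

theorem deriv_eq_weight_mul {s : ℝ} (hs : 0 < s) : deriv φ s = weight φ s * s := by
  rw [weight, if_pos hs, div_mul_cancel₀ _ hs.ne']

theorem CondC3.differentiableAt {κ s : ℝ} (h3 : CondC3 κ φ) (hs : 0 < s) :
    DifferentiableAt ℝ φ s :=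
  (h3.contDiff.differentiableOn (by norm_num)).differentiableAt (Ioi_mem_nhds hs)

theorem CondC3.differentiableAt_deriv {κ s : ℝ} (h3 : CondC3 κ φ) (hs : 0 < s) :
    DifferentiableAt ℝ (deriv φ) s :=
  ((h3.contDiff.deriv_of_isOpen (m := 1) isOpen_Ioi (by norm_num)).differentiableOn
    (by norm_num)).differentiableAt (Ioi_mem_nhds hs)

theorem continuousOn_sub_mul_sq {κ : ℝ} (h3 : CondC3 κ φ) (c : ℝ) :
    ContinuousOn (fun r => φ r - c * r ^ 2) (Ici 0) :=
  h3.continuous.sub (by fun_prop)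

theorem hasDerivAt_sub_mul_sq {κ : ℝ} (h3 : CondC3 κ φ) (c : ℝ) {r : ℝ} (hr : 0 < r) :
    HasDerivAt (fun r => φ r - c / 2 * r ^ 2) ((weight φ r - c) * r) r := by
  have h := (h3.differentiableAt hr).hasDerivAt.fun_sub ((hasDerivAt_pow 2 r).const_mul (c / 2))
  rw [deriv_eq_weight_mul hr] at h
  exact h.congr_deriv (by push_cast; ring)

/-- Since the weight is nonincreasing, `r ↦ φ(r) - a(s) r² / 2` is maximal at `r = s`. -/
theorem sub_le_weight_mul {κ : ℝ} (h2 : CondC2 φ) (h3 : CondC3 κ φ) {s t : ℝ}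
    (hs : 0 ≤ s) (ht : 0 ≤ t) :
    φ t - φ s ≤ weight φ s / 2 * (t ^ 2 - s ^ 2) := by
  have hc := continuousOn_sub_mul_sq h3 (weight φ s / 2)
  rcases le_total s t with h | h
  · have := antitoneOn_of_deriv_nonpos (convex_Icc s t)
      (hc.mono fun x hx => hs.trans hx.1) (fun x hx => by
        rw [interior_Icc] at hx
        exact (hasDerivAt_sub_mul_sq h3 _ (hs.trans_lt hx.1)).differentiableAt.differentiableWithinAt)
      (fun x hx => by
        rw [interior_Icc] at hx
        have hx0 := hs.trans_lt hx.1
        rw [(hasDerivAt_sub_mul_sq h3 _ hx0).deriv]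
        have := h2.antitone hs hx0.le hx.1.le
        nlinarith)
    have := this (left_mem_Icc.2 h) (right_mem_Icc.2 h) h
    simp only at this
    linarith
  · have := monotoneOn_of_deriv_nonneg (convex_Icc t s)
      (hc.mono fun x hx => ht.trans hx.1) (fun x hx => by
        rw [interior_Icc] at hx
        exact (hasDerivAt_sub_mul_sq h3 _ (ht.trans_lt hx.1)).differentiableAt.differentiableWithinAt)
      (fun x hx => by
        rw [interior_Icc] at hx
        have hx0 := ht.trans_lt hx.1
        rw [(hasDerivAt_sub_mul_sq h3 _ hx0).deriv]
        have := h2.antitone hx0.le hs hx.2.le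
        nlinarith)
    have := this (left_mem_Icc.2 h) (right_mem_Icc.2 h) h
    simp only at this
    linarith

/-- If the weight exceeds `m` and `κ m` on `[0, M]`, then `s ↦ φ'(s) - m s` is nondecreasing
there. -/
theorem monotoneOn_weight_sub_mul {κ m M : ℝ} (h3 : CondC3 κ φ) (hκ : 0 < κ)
    (hm : ∀ s, 0 ≤ s → s ≤ M → m ≤ weight φ s ∧ κ * m ≤ weight φ s) :
    MonotoneOn (fun s => (weight φ s - m) * s) (Icc 0 M) := by
  -- The point 0 is left out: `deriv φ 0` is two-sided and depends on irrelevant values of φ at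
  -- negative arguments.
  have hmono : MonotoneOn (fun s => deriv φ s - m * s) (Ioc 0 M) := by
    have hd : ∀ x, 0 < x →
        HasDerivAt (fun s => deriv φ s - m * s) (deriv (deriv φ) x - m) x := by
      intro x hx
      simpa using (h3.differentiableAt_deriv hx).hasDerivAt.fun_sub
        ((hasDerivAt_id x).const_mul m)
    refine monotoneOn_of_deriv_nonneg (convex_Ioc 0 M)
      (fun x hx => (hd x hx.1).continuousAt.continuousWithinAt) (fun x hx => ?_) fun x hx => ?_
    · rw [interior_Ioc] at hx
      exact (hd x hx.1).differentiableAt.differentiableWithinAt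
    · rw [interior_Ioc] at hx
      rw [(hd x hx.1).deriv]
      -- φ' ≤ κ φ'' s means a ≤ κ φ'', so κ m ≤ a forces φ'' ≥ m.
      have h1 := h3.deriv_le x hx.1
      rw [deriv_eq_weight_mul hx.1, ← mul_assoc] at h1
      have h4 := le_of_mul_le_mul_right h1 hx.1
      have h5 := (hm x hx.1.le hx.2.le).2
      have : κ * m ≤ κ * deriv (deriv φ) x := h5.trans h4
      linarith [le_of_mul_le_mul_left this hκ]
  intro s hs t ht hst
  rcases hs.1.eq_or_lt with rfl | hs0
  · simpa using mul_nonneg (sub_nonneg.2 (hm t ht.1 ht.2).1) ht.1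
  · have := hmono ⟨hs0, hs.2⟩ ⟨hs0.trans_le hst, ht.2⟩ hst
    simp only [deriv_eq_weight_mul hs0, deriv_eq_weight_mul (hs0.trans_le hst)] at this
    simp only
    linarith

theorem monotoneOn_weight_mul {κ : ℝ} (hκ : 0 < κ) (h2 : CondC2 φ) (h3 : CondC3 κ φ) :
    MonotoneOn (fun s => weight φ s * s) (Ici 0) := by
  intro s hs t ht hst
  simpa using monotoneOn_weight_sub_mul (m := 0) (M := t) h3 hκ
    (fun r hr _ => by simpa using (h2.pos r hr).le) ⟨hs, hst⟩ ⟨ht, le_rfl⟩ hst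

/-- In either order of s and t this rearranges to monotonicity of r a(r). The right side carries the
weight at s, the one in the dissipation, and no Lipschitz constant of a. -/
theorem abs_weight_sub_mul_le {κ : ℝ} (hκ : 0 < κ) (h2 : CondC2 φ) (h3 : CondC3 κ φ) {s t : ℝ}
    (hs : 0 ≤ s) (ht : 0 ≤ t) :
    |weight φ s - weight φ t| * t ≤ weight φ s * |s - t| := by
  have hmono := monotoneOn_weight_mul hκ h2 h3
  rcases le_total s t with h | h
  · have h1 := hmono hs ht h
    simp only at h1
    rw [abs_of_nonneg (sub_nonneg.2 (h2.antitone hs ht h)), abs_of_nonpos (sub_nonpos.2 h)]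
    linarith
  · have h1 := hmono ht hs h
    simp only at h1
    rw [abs_of_nonpos (sub_nonpos.2 (h2.antitone ht hs h)), abs_of_nonneg (sub_nonneg.2 h)]
    linarith

theorem abs_weight_sub_mul_norm_le {E : Type*} [NormedAddCommGroup E] {κ : ℝ} (hκ : 0 < κ) (h2 : CondC2 φ) (h3 : CondC3 κ φ)
    (a b : E) :
    |weight φ ‖a‖ - weight φ ‖b‖| * ‖b‖ ≤ weight φ ‖a‖ * ‖b - a‖ :=
  (abs_weight_sub_mul_le hκ h2 h3 (norm_nonneg a) (norm_nonneg b)).trans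
    (mul_le_mul_of_nonneg_left (by
      rw [norm_sub_rev]
      exact abs_norm_sub_norm_le a b) (h2.pos _ (norm_nonneg a)).le)

variable {E : Type*} [NormedAddCommGroup E] [InnerProductSpace ℝ E]

/-- The one-step energy estimate of the linearised flux. -/
theorem sub_add_le_weight_mul_inner {κ : ℝ} (h2 : CondC2 φ) (h3 : CondC3 κ φ) (a b : E) :
    φ ‖b‖ - φ ‖a‖ + weight φ ‖a‖ * ‖b - a‖ ^ 2 / 2 ≤ weight φ ‖a‖ * inner ℝ b (b - a) := by
  have h := sub_le_weight_mul h2 h3 (norm_nonneg a) (norm_nonneg b)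
  rw [norm_sub_sq_real, inner_sub_right, real_inner_self_eq_norm_sq]
  linarith

/-- Strong monotonicity of the flux on bounded sets. -/
theorem mul_norm_sub_sq_le_inner {κ m M : ℝ} (h3 : CondC3 κ φ) (hκ : 0 < κ)
    (hm : ∀ s, 0 ≤ s → s ≤ M → m ≤ weight φ s ∧ κ * m ≤ weight φ s) {a b : E}
    (ha : ‖a‖ ≤ M) (hb : ‖b‖ ≤ M) :
    m * ‖a - b‖ ^ 2 ≤ inner ℝ (weight φ ‖a‖ • a - weight φ ‖b‖ • b) (a - b) := by
  have hmono := monotoneOn_weight_sub_mul h3 hκ hm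
  have hA := (hm _ (norm_nonneg a) ha).1
  have hB := (hm _ (norm_nonneg b) hb).1
  have hab := real_inner_le_norm a b
  -- With A = a(|a|) - m and B = a(|b|) - m, Cauchy–Schwarz bounds the difference of the two sides
  -- of the claim below by (A|a| - B|b|)(|a| - |b|).
  have key : 0 ≤ ((weight φ ‖a‖ - m) * ‖a‖ - (weight φ ‖b‖ - m) * ‖b‖) * (‖a‖ - ‖b‖) := by
    rcases le_total ‖a‖ ‖b‖ with h | h
    · have := hmono ⟨norm_nonneg a, ha⟩ ⟨norm_nonneg b, hb⟩ h
      exact mul_nonneg_of_nonpos_of_nonpos (sub_nonpos.2 this) (sub_nonpos.2 h)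
    · have := hmono ⟨norm_nonneg b, hb⟩ ⟨norm_nonneg a, ha⟩ h
      exact mul_nonneg (sub_nonneg.2 this) (sub_nonneg.2 h)
  rw [norm_sub_sq_real, inner_sub_left, inner_sub_right, inner_sub_right]
  simp only [real_inner_smul_left, real_inner_self_eq_norm_sq]
  rw [real_inner_comm a b]
  nlinarith [mul_le_mul_of_nonneg_left hab (sub_nonneg.2 hA),
    mul_le_mul_of_nonneg_left hab (sub_nonneg.2 hB)]

/-- The pointwise error estimate: `a`, `b` are the old and new semi-implicit gradients, `c` is the
new implicit gradient. -/
theorem inner_error_le {κ m M W : ℝ} (hκ : 0 < κ) (h2 : CondC2 φ) (h3 : CondC3 κ φ)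
    (hm0 : 0 < m)
    (hm : ∀ s, 0 ≤ s → s ≤ M → m ≤ weight φ s ∧ κ * m ≤ weight φ s)
    (hW : ∀ s, 0 ≤ s → weight φ s ≤ W) {a b c : E} (hb : ‖b‖ ≤ M) (hc : ‖c‖ ≤ M) :
    weight φ ‖a‖ * inner ℝ b (c - b) - weight φ ‖c‖ * inner ℝ c (c - b) ≤
      W / (4 * m) * (weight φ ‖a‖ * ‖b - a‖ ^ 2) := by
  have h1 := mul_norm_sub_sq_le_inner h3 hκ hm hc hb
  have h4 := abs_weight_sub_mul_norm_le hκ h2 h3 a b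
  have hwa := h2.pos _ (norm_nonneg a)
  rw [inner_sub_left, real_inner_smul_left, real_inner_smul_left] at h1
  have h5 : (weight φ ‖a‖ - weight φ ‖b‖) * inner ℝ b (c - b) ≤
      weight φ ‖a‖ * ‖b - a‖ * ‖c - b‖ := by
    refine (le_abs_self _).trans ?_
    rw [abs_mul]
    calc _ ≤ |weight φ ‖a‖ - weight φ ‖b‖| * (‖b‖ * ‖c - b‖) :=
          mul_le_mul_of_nonneg_left (abs_real_inner_le_norm _ _) (abs_nonneg _)
      _ = |weight φ ‖a‖ - weight φ ‖b‖| * ‖b‖ * ‖c - b‖ := by ring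
      _ ≤ _ := mul_le_mul_of_nonneg_right h4 (norm_nonneg _)
  -- Young's inequality, scaled so that m‖c - b‖² is exactly what monotonicity in `h1` absorbs.
  have h6 : weight φ ‖a‖ * ‖b - a‖ * ‖c - b‖ ≤
      m * ‖c - b‖ ^ 2 + weight φ ‖a‖ / (4 * m) * (weight φ ‖a‖ * ‖b - a‖ ^ 2) := by
    have : m * ‖c - b‖ ^ 2 + weight φ ‖a‖ / (4 * m) * (weight φ ‖a‖ * ‖b - a‖ ^ 2) -
        weight φ ‖a‖ * ‖b - a‖ * ‖c - b‖ =
        (2 * m * ‖c - b‖ - weight φ ‖a‖ * ‖b - a‖) ^ 2 / (4 * m) := by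
      field_simp
      ring
    have h0 : 0 ≤ (2 * m * ‖c - b‖ - weight φ ‖a‖ * ‖b - a‖) ^ 2 / (4 * m) := by positivity
    linarith
  -- Only one of the two factors a(|a|) is replaced by W; the other is kept for the dissipation.
  have h7 : weight φ ‖a‖ / (4 * m) * (weight φ ‖a‖ * ‖b - a‖ ^ 2) ≤
      W / (4 * m) * (weight φ ‖a‖ * ‖b - a‖ ^ 2) := by
    have := hW _ (norm_nonneg a)
    gcongr
  linarith

end Density

/-! ### Finite element functions -/

section FiniteElements

variable {d : ℕ} {Ω : Set (EuclideanSpace ℝ (Fin d))}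
  {𝒯 : Geometry.SimplicialComplex ℝ (EuclideanSpace ℝ (Fin d))}

/-- Almost every point of `Ω` lies in the interior of an element. -/
theorem IsTriangulation.ae_exists_mem_interior (h𝒯 : IsTriangulation Ω 𝒯) :
    ∀ᵐ x ∂volume.restrict Ω, ∃ T ∈ elements 𝒯,
      x ∈ interior (convexHull ℝ (T : Set (EuclideanSpace ℝ (Fin d)))) := by
  have hnull : ∀ᵐ x ∂(volume : Measure (EuclideanSpace ℝ (Fin d))), ∀ s ∈ 𝒯.faces,
      x ∈ convexHull ℝ (s : Set (EuclideanSpace ℝ (Fin d))) →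
      s ∈ elements 𝒯 ∧ x ∈ interior (convexHull ℝ (s : Set (EuclideanSpace ℝ (Fin d)))) := by
    rw [ae_ball_iff h𝒯.finite.countable]
    intro s hs
    -- A full simplex has null boundary by convexity; a lower-dimensional one lies in a proper
    -- affine subspace.
    by_cases hcard : s.card = d + 1
    · have hfr := (convex_convexHull ℝ (s : Set (EuclideanSpace ℝ (Fin d)))).addHaar_frontier
        volume
      filter_upwards [measure_eq_zero_iff_ae_notMem.1 hfr] with x hx hxs
      refine ⟨⟨hs, hcard⟩, ?_⟩
      by_contra hxi
      exact hx ⟨subset_closure hxs, hxi⟩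
    · have hspan : affineSpan ℝ (s : Set (EuclideanSpace ℝ (Fin d))) ≠ ⊤ := by
        intro htop
        refine hcard ?_
        have h := (𝒯.indep hs).affineSpan_eq_top_iff_card_eq_finrank_add_one
        rw [Subtype.range_coe_subtype] at h
        simpa using h.1 (by simpa using htop)
      have h0 := Measure.addHaar_affineSubspace volume _ hspan
      filter_upwards [measure_eq_zero_iff_ae_notMem.1 h0] with x hx hxs
      exact absurd (convexHull_subset_affineSpan _ hxs) hx
  refine ae_restrict_of_ae_restrict_of_subset subset_closure ?_
  rw [ae_restrict_iff' isClosed_closure.measurableSet]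
  filter_upwards [hnull] with x hx hxΩ
  rw [← h𝒯.space_eq, Geometry.SimplicialComplex.mem_space_iff] at hxΩ
  obtain ⟨s, hs, hxs⟩ := hxΩ
  exact ⟨s, hx s hs hxs⟩

theorem IsTriangulation.convexHull_subset (h𝒯 : IsTriangulation Ω 𝒯)
    {T : Finset (EuclideanSpace ℝ (Fin d))} (hT : T ∈ elements 𝒯) :
    convexHull ℝ (T : Set (EuclideanSpace ℝ (Fin d))) ⊆ closure Ω :=
  h𝒯.space_eq ▸ Geometry.SimplicialComplex.convexHull_subset_space hT.1

theorem meshSize_pos (hd : 1 ≤ d) (h𝒯 : IsTriangulation Ω 𝒯)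
    {T : Finset (EuclideanSpace ℝ (Fin d))} (hT : T ∈ elements 𝒯) : 0 < meshSize 𝒯 := by
  have hfin : (elements 𝒯).Finite := h𝒯.finite.subset fun T hT => hT.1
  refine lt_of_lt_of_le ?_ (le_csSup (hfin.image _).bddAbove (mem_image_of_mem _ hT))
  simp only [convexHull_diam]
  obtain ⟨x, hx, y, hy, hxy⟩ := Finset.one_lt_card.1 (show 1 < T.card by rw [hT.2]; omega)
  exact (dist_pos.2 hxy).trans_le (Metric.dist_le_diam_of_mem T.finite_toSet.isBounded hx hy)

theorem meshSize_le_diam (hΩ : Bornology.IsBounded Ω) (h𝒯 : IsTriangulation Ω 𝒯) :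
    meshSize 𝒯 ≤ Metric.diam Ω := by
  refine Real.sSup_le ?_ Metric.diam_nonneg
  rintro _ ⟨T, hT, rfl⟩
  rw [← Metric.diam_closure Ω]
  exact Metric.diam_mono (h𝒯.convexHull_subset hT) hΩ.closure

/-- The affine formula is kept on the closed simplex, since the inverse estimate evaluates `v` at
points that may lie on its boundary. -/
theorem feSpace.exists_hasGradientAt {v : EuclideanSpace ℝ (Fin d) → ℝ} (hv : v ∈ feSpace Ω 𝒯)
    {T : Finset (EuclideanSpace ℝ (Fin d))} (hT : T ∈ elements 𝒯) :
    ∃ z : EuclideanSpace ℝ (Fin d),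
      (∀ x ∈ interior (convexHull ℝ (T : Set (EuclideanSpace ℝ (Fin d)))), HasGradientAt v z x) ∧
      ∀ x ∈ convexHull ℝ (T : Set (EuclideanSpace ℝ (Fin d))),
      ∀ y ∈ convexHull ℝ (T : Set (EuclideanSpace ℝ (Fin d))), v y - v x = inner ℝ z (y - x) := by
  obtain ⟨g, hg⟩ := hv.2 T hT
  have hlin : ∀ x y, g y - g x = g.linear (y - x) := fun x y => by
    simpa using (g.linearMap_vsub y x).symm
  refine ⟨(InnerProductSpace.toDual ℝ _).symm g.linear.toContinuousLinearMap, fun x hx => ?_,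
    fun x hx y hy => ?_⟩
  · rw [hasGradientAt_iff_hasFDerivAt, LinearIsometryEquiv.apply_symm_apply]
    have hgd : HasFDerivAt g g.linear.toContinuousLinearMap x := by
      have h := (g.linear.toContinuousLinearMap.hasFDerivAt (x := x)).add_const (g 0)
      refine h.congr_of_eventuallyEq (Eventually.of_forall fun y => ?_)
      have := hlin 0 y
      rw [sub_zero] at this
      simp only [LinearMap.coe_toContinuousLinearMap']
      linarith
    exact hgd.congr_of_eventuallyEq
      (eventually_of_mem (mem_interior_iff_mem_nhds.1 hx) fun y hy => hg hy)
  · rw [hg hx, hg hy, hlin, InnerProductSpace.toDual_symm_apply,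
      LinearMap.coe_toContinuousLinearMap']

theorem feSpace.ae_differentiableAt (h𝒯 : IsTriangulation Ω 𝒯)
    {v : EuclideanSpace ℝ (Fin d) → ℝ} (hv : v ∈ feSpace Ω 𝒯) :
    ∀ᵐ x ∂volume.restrict Ω, DifferentiableAt ℝ v x := by
  filter_upwards [h𝒯.ae_exists_mem_interior] with x ⟨T, hT, hx⟩
  obtain ⟨z, hz, -⟩ := feSpace.exists_hasGradientAt hv hT
  exact (hz x hx).differentiableAt

/-- The inverse estimate: the gradient of a finite element function is bounded by its maximum
divided by the mesh size. -/
theorem feSpace.ae_norm_gradient_le (hd : 1 ≤ d) {σ M : ℝ} (hσ : 0 < σ)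
    (h𝒯 : IsTriangulation Ω 𝒯) (hσ𝒯 : IsQuasiUniform σ 𝒯)
    {v : EuclideanSpace ℝ (Fin d) → ℝ} (hv : v ∈ feSpace Ω 𝒯)
    (hM : ∀ x ∈ closure Ω, |v x| ≤ M) :
    ∀ᵐ x ∂volume.restrict Ω, ‖∇ v x‖ ≤ M / (σ * meshSize 𝒯) := by
  filter_upwards [h𝒯.ae_exists_mem_interior] with x ⟨T, hT, hx⟩
  obtain ⟨z, hz, hzv⟩ := feSpace.exists_hasGradientAt hv hT
  rw [(hz x hx).gradient]
  have hr : 0 < σ * meshSize 𝒯 := mul_pos hσ (meshSize_pos hd h𝒯 hT)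
  set r := σ * meshSize 𝒯
  obtain ⟨y, hy⟩ := hσ𝒯 T hT
  rw [le_div_iff₀ hr]
  rcases eq_or_ne z 0 with rfl | hz0
  · rw [norm_zero, zero_mul]
    exact (abs_nonneg _).trans (hM x (h𝒯.convexHull_subset hT (interior_subset hx)))
  have hz1 : ‖z‖ ≠ 0 := norm_ne_zero_iff.2 hz0
  -- The diameter of the inscribed ball in direction z has length 2r, and v varies along it by 2r‖z‖
  -- ≤ 2M.
  have hnorm : ‖(r / ‖z‖) • z‖ = r := by
    rw [norm_smul, norm_div, norm_norm, div_mul_cancel₀ _ hz1, Real.norm_of_nonneg hr.le]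
  have h1 : y + (r / ‖z‖) • z ∈ convexHull ℝ (T : Set (EuclideanSpace ℝ (Fin d))) :=
    hy (by simp [hnorm, r])
  have h2 : y - (r / ‖z‖) • z ∈ convexHull ℝ (T : Set (EuclideanSpace ℝ (Fin d))) :=
    hy (by simp [hnorm, r])
  have h := hzv _ h2 _ h1
  rw [show y + (r / ‖z‖) • z - (y - (r / ‖z‖) • z) = (2 * (r / ‖z‖)) • z by module,
    real_inner_smul_right, real_inner_self_eq_norm_sq] at h
  have e : 2 * (r / ‖z‖) * ‖z‖ ^ 2 = 2 * (‖z‖ * r) := by field_simp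
  have b1 := abs_le.1 (hM _ (h𝒯.convexHull_subset hT h1))
  have b2 := abs_le.1 (hM _ (h𝒯.convexHull_subset hT h2))
  linarith

theorem feSpace.sub_mem {v w : EuclideanSpace ℝ (Fin d) → ℝ} (hv : v ∈ feSpace Ω 𝒯)
    (hw : w ∈ feSpace Ω 𝒯) : v - w ∈ feSpace Ω 𝒯 := by
  refine ⟨hv.1.sub hw.1, fun T hT => ?_⟩
  obtain ⟨g, hg⟩ := hv.2 T hT
  obtain ⟨k, hk⟩ := hw.2 T hT
  exact ⟨g - k, fun x hx => by simp [hg hx, hk hx]⟩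

theorem feSpaceD.sub_mem {ΓD : Set (EuclideanSpace ℝ (Fin d))}
    {v w : EuclideanSpace ℝ (Fin d) → ℝ} (hv : v ∈ feSpaceD Ω ΓD 𝒯)
    (hw : w ∈ feSpaceD Ω ΓD 𝒯) : v - w ∈ feSpaceD Ω ΓD 𝒯 := by
  refine ⟨feSpace.sub_mem hv.1 hw.1, ?_⟩
  filter_upwards [hv.2, hw.2] with x hx hy
  simp [hx, hy]

theorem feSpace.ae_gradient_sub (h𝒯 : IsTriangulation Ω 𝒯)
    {v w : EuclideanSpace ℝ (Fin d) → ℝ} (hv : v ∈ feSpace Ω 𝒯) (hw : w ∈ feSpace Ω 𝒯) :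
    ∀ᵐ x ∂volume.restrict Ω, ∇ (v - w) x = ∇ v x - ∇ w x := by
  filter_upwards [feSpace.ae_differentiableAt h𝒯 hv, feSpace.ae_differentiableAt h𝒯 hw]
    with x hx hy
  simp only [gradient, fderiv_sub hx hy, map_sub]

theorem feSpace.exists_abs_le (hΩb : Bornology.IsBounded Ω)
    {v : EuclideanSpace ℝ (Fin d) → ℝ} (hv : v ∈ feSpace Ω 𝒯) :
    ∃ M, ∀ x ∈ closure Ω, |v x| ≤ M :=
  (Metric.isCompact_of_isClosed_isBounded isClosed_closure hΩb.closure).exists_bound_of_continuousOn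
    hv.1

theorem feSpace.exists_ae_norm_gradient_le (hd : 1 ≤ d) {σ : ℝ} (hσ : 0 < σ)
    (hΩb : Bornology.IsBounded Ω) (h𝒯 : IsTriangulation Ω 𝒯) (hσ𝒯 : IsQuasiUniform σ 𝒯)
    {v : EuclideanSpace ℝ (Fin d) → ℝ} (hv : v ∈ feSpace Ω 𝒯) :
    ∃ M, ∀ᵐ x ∂volume.restrict Ω, ‖∇ v x‖ ≤ M :=
  let ⟨_, hM⟩ := feSpace.exists_abs_le hΩb hv
  ⟨_, feSpace.ae_norm_gradient_le hd hσ h𝒯 hσ𝒯 hv hM⟩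

/-- A finite element function is bounded on the closure of `Ω` by its essential supremum. -/
theorem feSpace.abs_le_of_eLpNorm_le (hΩ : IsOpen Ω) {v : EuclideanSpace ℝ (Fin d) → ℝ}
    (hv : v ∈ feSpace Ω 𝒯) {M : ℝ} (hM0 : 0 ≤ M)
    (hM : eLpNorm v ⊤ (volume.restrict Ω) ≤ ENNReal.ofReal M) :
    ∀ x ∈ closure Ω, |v x| ≤ M := by
  have hae : ∀ᵐ x ∂volume.restrict Ω, |v x| ≤ M := by
    rw [eLpNorm_exponent_top] at hM
    filter_upwards [ae_le_eLpNormEssSup (f := v) (μ := volume.restrict Ω)] with x hx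
    have := hx.trans hM
    rwa [← ofReal_norm, ENNReal.ofReal_le_ofReal_iff hM0] at this
  have hΩM : ∀ x ∈ Ω, |v x| ≤ M := by
    have hc : ContinuousOn (fun x => |v x|) Ω := (hv.1.mono subset_closure).abs
    -- Taking the maximum with M turns the a.e. inequality into an a.e. equality of continuous
    -- functions.
    have h := Measure.eqOn_open_of_ae_eq (μ := volume) (U := Ω)
      (f := fun x => max (|v x|) M) (g := fun _ => M)
      (by filter_upwards [hae] with x hx using max_eq_right hx) hΩ
      (hc.sup continuousOn_const) continuousOn_const
    exact fun x hx => max_eq_right_iff.1 (h hx)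
  exact fun x hx => le_on_closure (f := fun x => |v x|) (g := fun _ => M) hΩM hv.1.abs
    continuousOn_const hx

theorem feSpace.aestronglyMeasurable (hΩ : IsOpen Ω) {v : EuclideanSpace ℝ (Fin d) → ℝ}
    (hv : v ∈ feSpace Ω 𝒯) : AEStronglyMeasurable v (volume.restrict Ω) :=
  (hv.1.mono subset_closure).aestronglyMeasurable hΩ.measurableSet

theorem feSpace.memLp (hΩ : IsOpen Ω) (hΩb : Bornology.IsBounded Ω)
    {v : EuclideanSpace ℝ (Fin d) → ℝ} (hv : v ∈ feSpace Ω 𝒯) (q : ENNReal) :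
    MemLp v q (volume.restrict Ω) := by
  obtain ⟨M, hM⟩ := feSpace.exists_abs_le hΩb hv
  have : IsFiniteMeasure ((volume : Measure (EuclideanSpace ℝ (Fin d))).restrict Ω) :=
    ⟨by simpa using hΩb.measure_lt_top⟩
  exact MemLp.of_bound (feSpace.aestronglyMeasurable hΩ hv) M
    (ae_restrict_of_forall_mem hΩ.measurableSet fun x hx => hM x (subset_closure hx))

end FiniteElements

/-! ### Measurability and integrability of the nonlinear integrands. -/

section Measurability

variable {d : ℕ}

theorem measurable_gradient (v : EuclideanSpace ℝ (Fin d) → ℝ) : Measurable (∇ v) :=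
  (InnerProductSpace.toDual ℝ _).symm.continuous.measurable.comp (measurable_fderiv ℝ v)

/-- Composition with the gradient norm only requires continuity on `[0, ∞)`. -/
theorem measurable_comp_norm {ψ : ℝ → ℝ} (hψ : ContinuousOn ψ (Ici 0))
    (v : EuclideanSpace ℝ (Fin d) → ℝ) : Measurable fun x => ψ ‖∇ v x‖ := by
  have h : Continuous fun r => ψ (max r 0) :=
    hψ.comp_continuous (by fun_prop) fun r => le_max_right r 0
  have := h.measurable.comp (measurable_gradient v).norm
  simpa [Function.comp_def] using this

/-- The weight is at most its value at 0, so no gradient bound on `u` is needed. -/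
theorem CondC2.integrable_weight_mul_inner {φ : ℝ → ℝ} (h2 : CondC2 φ)
    {μ : Measure (EuclideanSpace ℝ (Fin d))} [IsFiniteMeasure μ]
    (u v w : EuclideanSpace ℝ (Fin d) → ℝ)
    (hv : ∃ M, ∀ᵐ x ∂μ, ‖∇ v x‖ ≤ M) (hw : ∃ M, ∀ᵐ x ∂μ, ‖∇ w x‖ ≤ M) :
    Integrable (fun x => weight φ ‖∇ u x‖ * inner ℝ (∇ v x) (∇ w x)) μ := by
  obtain ⟨M, hM⟩ := hv
  obtain ⟨N, hN⟩ := hw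
  refine Integrable.of_bound (C := weight φ 0 * (M * N)) ?_ ?_
  · exact ((measurable_comp_norm h2.continuous u).mul
      ((measurable_gradient v).inner (measurable_gradient w))).aestronglyMeasurable
  · filter_upwards [hM, hN] with x hx hy
    have hpos := h2.pos _ (norm_nonneg (∇ u x))
    rw [norm_mul, Real.norm_of_nonneg hpos.le]
    refine mul_le_mul (h2.antitone self_mem_Ici (norm_nonneg _) (norm_nonneg _)) ?_ (norm_nonneg _)
      (h2.pos 0 le_rfl).le
    exact (norm_inner_le_norm _ _).trans
      (mul_le_mul hx hy (norm_nonneg _) ((norm_nonneg _).trans hx))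

theorem CondC3.integrable_comp_norm_gradient {κ : ℝ} {φ : ℝ → ℝ} (h3 : CondC3 κ φ)
    {μ : Measure (EuclideanSpace ℝ (Fin d))} [IsFiniteMeasure μ]
    (v : EuclideanSpace ℝ (Fin d) → ℝ) (hv : ∃ M, ∀ᵐ x ∂μ, ‖∇ v x‖ ≤ M) :
    Integrable (fun x => φ ‖∇ v x‖) μ := by
  obtain ⟨M, hM⟩ := hv
  obtain ⟨C, hC⟩ := (isCompact_Icc (a := (0 : ℝ)) (b := M)).exists_bound_of_continuousOn
    (h3.continuous.mono fun x hx => hx.1)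
  refine Integrable.of_bound (C := C)
    (measurable_comp_norm h3.continuous v).aestronglyMeasurable ?_
  filter_upwards [hM] with x hx using hC _ ⟨norm_nonneg _, hx⟩

end Measurability

/-! ### The schemes -/

section Schemes

variable {d : ℕ} {Ω ΓD : Set (EuclideanSpace ℝ (Fin d))}
  {𝒯 : Geometry.SimplicialComplex ℝ (EuclideanSpace ℝ (Fin d))} {φ : ℝ → ℝ} {σ κ τ : ℝ}

/-- The numerical dissipation `∫_Ω a(|∇u|) |∇(w - u)|² dx` of a semi-implicit step from `u`
to `w`. -/
noncomputable def dissipation (φ : ℝ → ℝ) (Ω : Set (EuclideanSpace ℝ (Fin d)))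
    (u w : EuclideanSpace ℝ (Fin d) → ℝ) : ℝ :=
  ∫ x in Ω, weight φ ‖∇ u x‖ * ‖∇ (w - u) x‖ ^ 2

/-- One step of the semi-implicit scheme decreases the energy at least by half the numerical
dissipation. -/
theorem energy_add_dissipation_le (hd : 1 ≤ d) (hΩb : Bornology.IsBounded Ω) (hσ : 0 < σ)
    (h2 : CondC2 φ) (h3 : CondC3 κ φ) (h𝒯 : IsTriangulation Ω 𝒯) (hσ𝒯 : IsQuasiUniform σ 𝒯)
    (hτ : 0 < τ) {u w : EuclideanSpace ℝ (Fin d) → ℝ} (hu : u ∈ feSpaceD Ω ΓD 𝒯)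
    (hw : w ∈ feSpaceD Ω ΓD 𝒯)
    (hstep : ∀ v ∈ feSpaceD Ω ΓD 𝒯, (∫ x in Ω, (w x - u x) / τ * v x) +
      (∫ x in Ω, weight φ ‖∇ u x‖ * inner ℝ (∇ w x) (∇ v x)) = 0) :
    energy φ Ω w + dissipation φ Ω u w / 2 ≤ energy φ Ω u := by
  have : IsFiniteMeasure ((volume : Measure (EuclideanSpace ℝ (Fin d))).restrict Ω) :=
    ⟨by simpa using hΩb.measure_lt_top⟩
  have hv := feSpaceD.sub_mem hw hu
  have hbd : ∀ {v}, v ∈ feSpaceD Ω ΓD 𝒯 → ∃ M, ∀ᵐ x ∂volume.restrict Ω, ‖∇ v x‖ ≤ M :=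
    fun h => feSpace.exists_ae_norm_gradient_le hd hσ hΩb h𝒯 hσ𝒯 h.1
  -- Testing with w - u makes the time term ‖w - u‖²/τ, which is dropped.
  have h0 : 0 ≤ ∫ x in Ω, (w x - u x) / τ * (w - u) x := by
    refine integral_nonneg fun x => ?_
    rw [Pi.sub_apply, div_mul_eq_mul_div]
    exact div_nonneg (mul_self_nonneg _) hτ.le
  have hI := h2.integrable_weight_mul_inner u w (w - u) (hbd hw) (hbd hv)
  have hD := h2.integrable_weight_mul_inner u (w - u) (w - u) (hbd hv) (hbd hv)
  simp only [real_inner_self_eq_norm_sq] at hD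
  have hEw := h3.integrable_comp_norm_gradient w (hbd hw)
  have hEu := h3.integrable_comp_norm_gradient u (hbd hu)
  have hEd : Integrable (fun x => φ ‖∇ w x‖ - φ ‖∇ u x‖) (volume.restrict Ω) := hEw.sub hEu
  have hle : ∫ x in Ω, ((φ ‖∇ w x‖ - φ ‖∇ u x‖) + weight φ ‖∇ u x‖ * ‖∇ (w - u) x‖ ^ 2 / 2) ≤
      ∫ x in Ω, weight φ ‖∇ u x‖ * inner ℝ (∇ w x) (∇ (w - u) x) := by
    refine integral_mono_ae (hEd.add (hD.div_const 2)) hI ?_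
    filter_upwards [feSpace.ae_gradient_sub h𝒯 hw.1 hu.1] with x hx
    simp only [hx]
    exact sub_add_le_weight_mul_inner h2 h3 _ _
  rw [integral_add hEd (hD.div_const 2), integral_sub hEw hEu, integral_div] at hle
  have := hstep _ hv
  simp only [energy, dissipation]
  linarith

/-- One step of the error estimate. Here `u`, `w` are consecutive semi-implicit iterates and
`u'`, `w'` consecutive implicit ones. -/
theorem integral_sq_sub_le (hd : 1 ≤ d) (hΩ : IsOpen Ω) (hΩb : Bornology.IsBounded Ω)
    (hσ : 0 < σ) (hκ : 0 < κ)
    (h2 : CondC2 φ) (h3 : CondC3 κ φ) (h𝒯 : IsTriangulation Ω 𝒯) (hσ𝒯 : IsQuasiUniform σ 𝒯)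
    (hτ : 0 < τ) {m M W : ℝ} (hm0 : 0 < m)
    (hm : ∀ s, 0 ≤ s → s ≤ M → m ≤ weight φ s ∧ κ * m ≤ weight φ s)
    (hW : ∀ s, 0 ≤ s → weight φ s ≤ W)
    {u w u' w' : EuclideanSpace ℝ (Fin d) → ℝ} (hu : u ∈ feSpaceD Ω ΓD 𝒯)
    (hw : w ∈ feSpaceD Ω ΓD 𝒯) (hu' : u' ∈ feSpaceD Ω ΓD 𝒯) (hw' : w' ∈ feSpaceD Ω ΓD 𝒯)
    (hwM : ∀ᵐ x ∂volume.restrict Ω, ‖∇ w x‖ ≤ M)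
    (hwM' : ∀ᵐ x ∂volume.restrict Ω, ‖∇ w' x‖ ≤ M)
    (hstep : ∀ v ∈ feSpaceD Ω ΓD 𝒯, (∫ x in Ω, (w x - u x) / τ * v x) +
      (∫ x in Ω, weight φ ‖∇ u x‖ * inner ℝ (∇ w x) (∇ v x)) = 0)
    (hstep' : ∀ v ∈ feSpaceD Ω ΓD 𝒯, (∫ x in Ω, (w' x - u' x) / τ * v x) +
      (∫ x in Ω, weight φ ‖∇ w' x‖ * inner ℝ (∇ w' x) (∇ v x)) = 0) :
    (∫ x in Ω, (w' x - w x) ^ 2) - (∫ x in Ω, (u' x - u x) ^ 2) ≤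
      τ * W / (2 * m) * dissipation φ Ω u w := by
  have : IsFiniteMeasure ((volume : Measure (EuclideanSpace ℝ (Fin d))).restrict Ω) :=
    ⟨by simpa using hΩb.measure_lt_top⟩
  have hv := feSpaceD.sub_mem hw hu
  have he := feSpaceD.sub_mem hw' hw
  have heo := feSpaceD.sub_mem hu' hu
  have hv' := feSpaceD.sub_mem hw' hu'
  have hbd : ∀ {v}, v ∈ feSpaceD Ω ΓD 𝒯 → ∃ M, ∀ᵐ x ∂volume.restrict Ω, ‖∇ v x‖ ≤ M :=
    fun h => feSpace.exists_ae_norm_gradient_le hd hσ hΩb h𝒯 hσ𝒯 h.1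
  have hmem : ∀ {v}, v ∈ feSpaceD Ω ΓD 𝒯 → MemLp v 2 (volume.restrict Ω) :=
    fun h => feSpace.memLp hΩ hΩb h.1 2
  have hmul : ∀ {v z : EuclideanSpace ℝ (Fin d) → ℝ}, v ∈ feSpaceD Ω ΓD 𝒯 →
      z ∈ feSpaceD Ω ΓD 𝒯 → Integrable (fun x => v x / τ * z x) (volume.restrict Ω) := by
    intro v z h h'
    refine (((hmem h).integrable_mul (hmem h')).div_const τ).congr (ae_of_all _ fun x => ?_)
    simp only [Pi.mul_apply]
    ring
  have hI := h2.integrable_weight_mul_inner u w (w' - w) (hbd hw) (hbd he)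
  have hI' := h2.integrable_weight_mul_inner w' w' (w' - w) (hbd hw') (hbd he)
  have hD := h2.integrable_weight_mul_inner u (w - u) (w - u) (hbd hv) (hbd hv)
  simp only [real_inner_self_eq_norm_sq] at hD
  have hflux : (∫ x in Ω, weight φ ‖∇ u x‖ * inner ℝ (∇ w x) (∇ (w' - w) x)) -
      (∫ x in Ω, weight φ ‖∇ w' x‖ * inner ℝ (∇ w' x) (∇ (w' - w) x)) ≤
      W / (4 * m) * dissipation φ Ω u w := by
    rw [← integral_sub hI hI', dissipation, ← integral_const_mul]
    refine integral_mono_ae (hI.sub hI') (hD.const_mul _) ?_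
    filter_upwards [feSpace.ae_gradient_sub h𝒯 hw.1 hu.1, feSpace.ae_gradient_sub h𝒯 hw'.1 hw.1,
      hwM, hwM'] with x hx hx' hb hc
    simp only [hx, hx']
    exact inner_error_le hκ h2 h3 hm0 hm hW hb hc
  -- With e, e₀ the new and old errors, this is e² - e₀² ≤ 2(e - e₀)e.
  have htime : ((∫ x in Ω, (w' x - w x) ^ 2) - (∫ x in Ω, (u' x - u x) ^ 2)) / (2 * τ) ≤
      (∫ x in Ω, (w' x - u' x) / τ * (w' - w) x) - ∫ x in Ω, (w x - u x) / τ * (w' - w) x := by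
    have hsq := (hmem he).integrable_sq
    have hsqo := (hmem heo).integrable_sq
    have i1 : Integrable (fun x => (w' x - u' x) / τ * (w' - w) x) (volume.restrict Ω) :=
      hmul hv' he
    have i2 : Integrable (fun x => (w x - u x) / τ * (w' - w) x) (volume.restrict Ω) :=
      hmul hv he
    simp only [Pi.sub_apply] at hsq hsqo
    rw [← integral_sub hsq hsqo, ← integral_sub i1 i2, ← integral_div]
    refine integral_mono ((hsq.sub hsqo).div_const _) (i1.sub i2) fun x => ?_
    simp only [Pi.sub_apply]
    rw [div_le_iff₀ (by positivity)]
    have : ((w' x - u' x) / τ * (w' x - w x) - (w x - u x) / τ * (w' x - w x)) * (2 * τ) =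
        2 * ((w' x - w x) - (u' x - u x)) * (w' x - w x) := by
      field_simp
      ring
    rw [this]
    nlinarith [sq_nonneg ((w' x - w x) - (u' x - u x))]
  have e1 := hstep _ he
  have e2 := hstep' _ he
  have h := htime.trans (show _ ≤ W / (4 * m) * dissipation φ Ω u w by linarith)
  rw [div_le_iff₀ (by positivity)] at h
  refine h.trans_eq ?_
  field_simp
  ring

theorem energy_nonneg (h1 : CondC1 φ) (Ω : Set (EuclideanSpace ℝ (Fin d)))
    (u : EuclideanSpace ℝ (Fin d) → ℝ) : 0 ≤ energy φ Ω u :=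
  integral_nonneg fun _ => h1.nonneg _ (norm_nonneg _)

end Schemes

/-! ### Constants, summation over the steps and the final estimate. -/

/-- The lower bound on the weight on the range of the discrete gradients. -/
theorem le_weight_of_le_div {φ : ℝ → ℝ} {p c₁ ε ε₀ b D h κ : ℝ} (hp2 : p < 2) (hc₁ : 0 < c₁)
    (hε : 0 < ε) (hεε₀ : ε ≤ ε₀) (hb : 0 < b) (hκ : 0 < κ) (hh : 0 < h) (hhD : h ≤ D)
    (hlow : ∀ s : ℝ, 0 ≤ s → c₁ * (max s ε) ^ (p - 2) ≤ weight φ s) {s : ℝ} (hs : 0 ≤ s)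
    (hsb : s ≤ b / h) :
    min 1 κ⁻¹ * c₁ * (b + ε₀ * D) ^ (p - 2) * h ^ (2 - p) ≤ weight φ s ∧
      κ * (min 1 κ⁻¹ * c₁ * (b + ε₀ * D) ^ (p - 2) * h ^ (2 - p)) ≤ weight φ s := by
  have hD : 0 < D := hh.trans_le hhD
  have hε₀ : 0 < ε₀ := hε.trans_le hεε₀
  have hR : 0 < b + ε₀ * D := by positivity
  -- As p < 2, a lower bound on the weight needs an upper bound on max{s, ε} of order 1/h; for ε it
  -- comes from ε h ≤ ε₀ D.
  have hmax : max s ε ≤ (b + ε₀ * D) / h := by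
    refine max_le (hsb.trans ?_) ?_
    · gcongr
      exact le_add_of_nonneg_right (by positivity)
    · rw [le_div_iff₀ hh]
      have := mul_le_mul hεε₀ hhD hh.le hε₀.le
      linarith
  have hle : c₁ * (b + ε₀ * D) ^ (p - 2) * h ^ (2 - p) ≤ weight φ s := by
    refine le_trans ?_ (hlow s hs)
    have h1 := Real.rpow_le_rpow_of_nonpos (lt_max_of_lt_right hε) hmax
      (show p - 2 ≤ 0 by linarith)
    rw [Real.div_rpow hR.le hh.le, div_eq_mul_inv, ← Real.rpow_neg hh.le, neg_sub] at h1
    rw [mul_assoc]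
    exact mul_le_mul_of_nonneg_left h1 hc₁.le
  set X := c₁ * (b + ε₀ * D) ^ (p - 2) * h ^ (2 - p)
  have hX : 0 < X := by positivity
  have e : min 1 κ⁻¹ * c₁ * (b + ε₀ * D) ^ (p - 2) * h ^ (2 - p) = min 1 κ⁻¹ * X := by
    simp only [X]
    ring
  rw [e]
  constructor
  · refine le_trans ?_ hle
    exact mul_le_of_le_one_left hX.le (min_le_left _ _)
  · refine le_trans ?_ hle
    rw [← mul_assoc]
    refine mul_le_of_le_one_left hX.le ?_
    calc κ * min 1 κ⁻¹ ≤ κ * κ⁻¹ := mul_le_mul_of_nonneg_left (min_le_right _ _) hκ.le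
      _ = 1 := mul_inv_cancel₀ hκ.ne'

/-- The error bound in squared form. -/
theorem integral_sq_sub_le_energy {d : ℕ} (hd : 1 ≤ d) {Ω ΓD : Set (EuclideanSpace ℝ (Fin d))}
    (hΩ : IsOpen Ω) (hΩb : Bornology.IsBounded Ω)
    {𝒯 : Geometry.SimplicialComplex ℝ (EuclideanSpace ℝ (Fin d))} {φ : ℝ → ℝ} {σ κ τ : ℝ}
    (hσ : 0 < σ) (hκ : 0 < κ)
    (h1 : CondC1 φ) (h2 : CondC2 φ) (h3 : CondC3 κ φ) (h𝒯 : IsTriangulation Ω 𝒯)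
    (hσ𝒯 : IsQuasiUniform σ 𝒯)
    (hτ : 0 < τ) {m M W : ℝ} (hm0 : 0 < m)
    (hm : ∀ s, 0 ≤ s → s ≤ M → m ≤ weight φ s ∧ κ * m ≤ weight φ s)
    (hW : ∀ s, 0 ≤ s → weight φ s ≤ W) {K : ℕ} {u u' : ℕ → EuclideanSpace ℝ (Fin d) → ℝ}
    (hu : IsSemiImplicit φ Ω (feSpaceD Ω ΓD 𝒯) τ K u)
    (hu' : IsImplicit φ Ω (feSpaceD Ω ΓD 𝒯) τ K u')
    (h0 : EqOn (u' 0) (u 0) (closure Ω))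
    (huM : ∀ k ≤ K, ∀ᵐ x ∂volume.restrict Ω, ‖∇ (u k) x‖ ≤ M)
    (huM' : ∀ k ≤ K, ∀ᵐ x ∂volume.restrict Ω, ‖∇ (u' k) x‖ ≤ M) {k : ℕ} (hk : k ≤ K) :
    ∫ x in Ω, (u' k x - u k x) ^ 2 ≤ τ * W / m * energy φ Ω (u 0) := by
  have hWpos : 0 < W := (h2.pos 0 le_rfl).trans_le (hW 0 le_rfl)
  -- Keeping the current energy on the right makes the induction telescope.
  have key : ∀ k ≤ K, ∫ x in Ω, (u' k x - u k x) ^ 2 ≤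
      τ * W / m * (energy φ Ω (u 0) - energy φ Ω (u k)) := by
    intro k
    induction k with
    | zero =>
      intro _
      rw [sub_self, mul_zero]
      refine (setIntegral_eq_zero_of_forall_eq_zero fun x hx => ?_).le
      rw [h0 (subset_closure hx), sub_self, zero_pow two_ne_zero]
    | succ k ih =>
      intro hk
      have hk' : k ≤ K := by omega
      have hs := hu.2 (k + 1) (by omega) hk
      have hs' := hu'.2 (k + 1) (by omega) hk
      rw [Nat.add_sub_cancel] at hs hs'
      have hE := energy_add_dissipation_le hd hΩb hσ h2 h3 h𝒯 hσ𝒯 hτ (hu.1 k hk')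
        (hu.1 _ hk) hs
      have hstep := integral_sq_sub_le hd hΩ hΩb hσ hκ h2 h3 h𝒯 hσ𝒯 hτ hm0 hm hW (hu.1 k hk')
        (hu.1 _ hk) (hu'.1 k hk') (hu'.1 _ hk) (huM _ hk) (huM' _ hk) hs hs'
      have e : τ * W / (2 * m) * dissipation φ Ω (u k) (u (k + 1)) =
          τ * W / m * (dissipation φ Ω (u k) (u (k + 1)) / 2) := by
        field_simp
      have hle := mul_le_mul_of_nonneg_left
        (show dissipation φ Ω (u k) (u (k + 1)) / 2 ≤ energy φ Ω (u k) - energy φ Ω (u (k + 1)) by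
          linarith) (show 0 ≤ τ * W / m by positivity)
      have := ih hk'
      linarith
  refine (key k hk).trans (mul_le_mul_of_nonneg_left ?_ (by positivity))
  linarith [energy_nonneg h1 Ω (u k)]

theorem eLpNorm_two_le_of_integral_sq_le {α : Type*} {mα : MeasurableSpace α} {μ : Measure α}
    {f : α → ℝ} (hf : MemLp f 2 μ) {B : ℝ} (hB : 0 ≤ B) (h : ∫ x, f x ^ 2 ∂μ ≤ B ^ 2) :
    eLpNorm f 2 μ ≤ ENNReal.ofReal B := by
  rw [hf.eLpNorm_eq_integral_rpow_norm two_ne_zero ENNReal.ofNat_ne_top]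
  refine ENNReal.ofReal_le_ofReal ?_
  have e : ∫ x, ‖f x‖ ^ (2 : ENNReal).toReal ∂μ = ∫ x, f x ^ 2 ∂μ := by simp
  rw [e, ENNReal.toReal_ofNat, ← one_div, ← Real.sqrt_eq_rpow]
  exact Real.sqrt_le_iff.2 ⟨hB, h⟩

end PLaplaceFlow

open PLaplaceFlow
theorem proposition4p4 (d : ℕ) (hd : 1 ≤ d)
    (Ω : Set (EuclideanSpace ℝ (Fin d))) (hΩ : IsOpen Ω) (hΩb : Bornology.IsBounded Ω)
    (p : ℝ) (hp1 : 1 < p) (hp2 : p < 2)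
    (ε₀ : ℝ) (hε₀ : 0 < ε₀)
    (c₁ c₂ cinf σ κ : ℝ) (hc₁ : 0 < c₁) (hc₂ : 0 < c₂) (hcinf : 0 < cinf)
    (hσ : 0 < σ) (hκ : 0 < κ) :
    ∃ C : ℝ, 0 < C ∧
      ∀ (φ : ℝ → ℝ) (ε : ℝ), 0 < ε → ε ≤ ε₀ →
      CondC1 φ → CondC2 φ → CondC3 κ φ →
      (∀ s : ℝ, 0 ≤ s →
        c₁ * (max s ε) ^ (p - 2) ≤ weight φ s ∧ weight φ s ≤ c₂ * ε ^ (p - 2)) →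
      ∀ (ΓD : Set (EuclideanSpace ℝ (Fin d))), IsClosed ΓD → ΓD ⊆ frontier Ω →
      ∀ (𝒯 : Geometry.SimplicialComplex ℝ (EuclideanSpace ℝ (Fin d))),
      IsTriangulation Ω 𝒯 → IsQuasiUniform σ 𝒯 →
      ∀ (τ : ℝ), 0 < τ →
      ∀ (K : ℕ) (u u' : ℕ → EuclideanSpace ℝ (Fin d) → ℝ),
      IsSemiImplicit φ Ω (feSpaceD Ω ΓD 𝒯) τ K u →
      IsImplicit φ Ω (feSpaceD Ω ΓD 𝒯) τ K u' →
      EqOn (u' 0) (u 0) (closure Ω) →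
      (Finset.range (K + 1)).sup (fun k => eLpNorm (u k) ⊤ (volume.restrict Ω)) +
        (Finset.range (K + 1)).sup (fun k => eLpNorm (u' k) ⊤ (volume.restrict Ω)) ≤
          ENNReal.ofReal cinf →
      (Finset.range (K + 1)).sup (fun k => eLpNorm (u' k - u k) 2 (volume.restrict Ω)) ≤
        ENNReal.ofReal (C * (energy φ Ω (u 0)) ^ (1 / 2 : ℝ) * τ ^ (1 / 2 : ℝ) *
          (meshSize 𝒯 * ε) ^ ((p - 2) / 2)) := by
  have hdiam : 0 ≤ Metric.diam Ω := Metric.diam_nonneg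
  set b := cinf / σ with hb
  have hbpos : 0 < b := by positivity
  have hR : 0 < b + ε₀ * Metric.diam Ω := by positivity
  have hmin : 0 < min 1 κ⁻¹ := lt_min one_pos (inv_pos.2 hκ)
  set m₀ := min 1 κ⁻¹ * c₁ * (b + ε₀ * Metric.diam Ω) ^ (p - 2) with hm₀
  have hm₀pos : 0 < m₀ := by positivity
  -- Here m = m₀ h^(2-p) and W = c₂ ε^(p-2), so W/m = (c₂/m₀)(hε)^(p-2).
  refine ⟨√(c₂ / m₀), by positivity, ?_⟩
  intro φ ε hε hεε₀ h1 h2 h3 hweight ΓD _ _ 𝒯 h𝒯 hσ𝒯 τ hτ K u u' hu hu' h0 hsup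
  refine Finset.sup_le fun k hk => ?_
  have hkK : k ≤ K := by simpa [Nat.lt_succ_iff] using hk
  -- Without elements `meshSize 𝒯` is 0 by the convention for `sSup ∅`, but then Ω is null and the
  -- error vanishes.
  rcases (elements 𝒯).eq_empty_or_nonempty with hem | ⟨T, hT⟩
  · have hΩ0 : volume.restrict Ω = 0 := by
      have := h𝒯.ae_exists_mem_interior
      simpa [hem] using this
    simp [hΩ0]
  have hh : 0 < meshSize 𝒯 := meshSize_pos hd h𝒯 hT
  have hhD := meshSize_le_diam hΩb h𝒯
  have hEnonneg := energy_nonneg h1 Ω (u 0)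
  have hgrad : ∀ v ∈ feSpaceD Ω ΓD 𝒯, eLpNorm v ⊤ (volume.restrict Ω) ≤ ENNReal.ofReal cinf →
      ∀ᵐ x ∂volume.restrict Ω, ‖∇ v x‖ ≤ b / meshSize 𝒯 := by
    intro v hv hvc
    have := feSpace.ae_norm_gradient_le hd hσ h𝒯 hσ𝒯 hv.1
      (feSpace.abs_le_of_eLpNorm_le hΩ hv.1 hcinf.le hvc)
    rwa [hb, div_div]
  have hu_sup : ∀ k ≤ K, eLpNorm (u k) ⊤ (volume.restrict Ω) ≤ ENNReal.ofReal cinf :=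
    fun k hk => (Finset.le_sup (f := fun k => eLpNorm (u k) ⊤ (volume.restrict Ω))
      (Finset.mem_range.2 (Nat.lt_succ_of_le hk))).trans (le_self_add.trans hsup)
  have hu_sup' : ∀ k ≤ K, eLpNorm (u' k) ⊤ (volume.restrict Ω) ≤ ENNReal.ofReal cinf :=
    fun k hk => (Finset.le_sup (f := fun k => eLpNorm (u' k) ⊤ (volume.restrict Ω))
      (Finset.mem_range.2 (Nat.lt_succ_of_le hk))).trans (le_add_self.trans hsup)
  have hbound := integral_sq_sub_le_energy (m := m₀ * meshSize 𝒯 ^ (2 - p))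
    (M := b / meshSize 𝒯) (W := c₂ * ε ^ (p - 2)) hd hΩ hΩb hσ hκ h1 h2 h3 h𝒯 hσ𝒯 hτ
    (by positivity)
    (fun s hs hsM => le_weight_of_le_div hp2 hc₁ hε hεε₀ hbpos hκ hh hhD
      (fun s hs => (hweight s hs).1) hs hsM)
    (fun s hs => (hweight s hs).2) hu hu' h0
    (fun k hk => hgrad _ (hu.1 k hk) (hu_sup k hk))
    (fun k hk => hgrad _ (hu'.1 k hk) (hu_sup' k hk)) hkK
  refine eLpNorm_two_le_of_integral_sq_le
    (feSpace.memLp hΩ hΩb (feSpaceD.sub_mem (hu'.1 k hkK) (hu.1 k hkK)).1 2) (by positivity) ?_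
  refine hbound.trans_eq ?_
  have hX : ((meshSize 𝒯 * ε) ^ ((p - 2) / 2)) ^ 2 =
      ε ^ (p - 2) * (meshSize 𝒯 ^ (2 - p))⁻¹ := by
    rw [← Real.rpow_natCast, ← Real.rpow_mul (by positivity), Real.mul_rpow hh.le hε.le,
      ← Real.rpow_neg hh.le]
    push_cast
    rw [div_mul_cancel₀ _ (two_ne_zero), neg_sub, mul_comm]
  rw [mul_pow, mul_pow, mul_pow, hX, ← Real.sqrt_eq_rpow, ← Real.sqrt_eq_rpow,
    Real.sq_sqrt (by positivity), Real.sq_sqrt hEnonneg, Real.sq_sqrt hτ.le]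
  have : meshSize 𝒯 ^ (2 - p) ≠ 0 := (Real.rpow_pos_of_pos hh _).ne'
  field_simp
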